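/- Let $c,d\ge 1$ be integers and $\varepsilon\in\{1,-1\}$, let $\Gamma=\langle a,b\mid ab^c=b^{\varepsilon d}a\rangle$ be the corresponding Baumslag--Solitar group, and let $\Lambda\subseteq\Gamma$ be the submonoid generated by $a$ and $b$, regarded as a category of paths with one object. For $\alpha,\beta\in\Lambda$ say that $\beta$ extends $\alpha$ (and that $\alpha$ is an initial segment of $\beta$) if $\beta\in\alpha\Lambda$, and let $[\beta]$ be the set of initial segments of $\beta$. A nonempty subset $C\subseteq\Lambda$ is directed if any two elements of $C$ have a common extension in $C$, and hereditary if $[\beta]\subseteq C$ for all $\beta\in C$. Let $\Lambda^*$ be the set of directed hereditary subsets of $\Lambda$, and $\Lambda^{**}$ the set of its maximal elements under inclusion. Give $\Lambda^*$ the topology generated by the sets $$\widehat E=\{C\in\Lambda^*: C\cap\gamma\Lambda\subseteq E\text{ for some }\gamma\in C\},$$ where $E=\alpha\Lambda\setminus\bigcup_{m=1}^n\beta_m\Lambda$ with $\alpha\in\Lambda$, $n\ge0$ and $\beta_1,\dots,\beta_n\in\alpha\Lambda\setminus\{\alpha\}$, and let $\partial\Lambda=\overline{\Lambda^{**}}$.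 For $\alpha\in\Lambda$ and $C\in\Lambda^*$ put $\alpha C=\bigcup_{\beta\in C}[\alpha\beta]\in\Lambda^*$. Write $[0,d)=\{0,1,\dots,d-1\}$ and give $[0,d)^{\mathbb N}$ the product topology. For $i=(i_0,i_1,\dots)\in[0,d)^{\mathbb N}$ and $k\ge0$ let $$\alpha_k(i)=b^{i_0}ab^{i_1}a\cdots b^{i_k}a,\qquad C_\infty(i)=\bigcup_{k,p\ge0}[\alpha_k(i)b^p].$$ Define $\varphi:[0,d)^{\mathbb N}\to[0,d)^{\mathbb N}$ and integers $e_k=e_k(i)$ recursively by $\varphi(i)_0=i_0$, $e_0=\varepsilon$, and, for $k\ge1$, by letting $\varphi(i)_k\in[0,d)$ be the residue of $i_k-c\,e_{k-1}$ modulo $d$ and $e_k=-\varepsilon\lfloor (i_k-c\,e_{k-1})/d\rfloor$. Then: 1. $\Lambda^{**}$ is a closed subset of $\Lambda^*$, and thus $\partial\Lambda=\Lambda^{**}$. 2. The sets $C_\infty(i)$, $i\in[0,d)^{\mathbb N}$, are exactly the elements of $\partial\Lambda$, and $C_\infty(i)\mapsto i$ is a well-defined homeomorphism $h:\partial\Lambda\to[0,d)^{\mathbb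 N}$. 3. $\varphi$ is a homeomorphism of $[0,d)^{\mathbb N}$ satisfying $b^d\alpha_k(\varphi(i))=\alpha_k(i)b^{c\,e_k(i)}$ in $\Gamma$ for all $i$ and $k$. Left multiplication $C\mapsto b^dC$ maps $\partial\Lambda$ into itself, and $h(b^dC)=\varphi^{-1}(h(C))$ for all $C\in\partial\Lambda$. -/

import Mathlib

namespace BSPaths

/-! ### Directed hereditary subsets of a one-object category of paths

A category of paths with a single object is a monoid `M`; composition is multiplication.
In a monoid, Mathlib's `α ∣ β` means `∃ γ, β = α * γ`, i.e. `β` extends `α`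
(`α` is an initial segment of `β`). -/

section Monoid

variable {M : Type*} [Monoid M]

/-- The right ideal `αΛ` of all extensions of `α`. -/
def extensions (α : M) : Set M := {β | α ∣ β}

/-- Nonempty directed hereditary subsets. -/
def IsDirHered (C : Set M) : Prop :=
  C.Nonempty ∧ (∀ α ∈ C, ∀ β ∈ C, ∃ γ ∈ C, α ∣ γ ∧ β ∣ γ) ∧ ∀ α ∈ C, ∀ β, β ∣ α → β ∈ C

variable (M) in
/-- The space `Λ^*` of directed hereditary subsets. -/
structure DirHered where
  /-- The underlying subset. -/
  carrier : Set M
  isDirHered : IsDirHered carrier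

/-- The set `Ê` of those `C` with `C ∩ γΛ ⊆ E` for some `γ ∈ C`. -/
def hat (E : Set M) : Set (DirHered M) :=
  {C | ∃ γ ∈ C.carrier, C.carrier ∩ extensions γ ⊆ E}

/-- The topology of `Λ^*`, generated by the sets `Ê` with
`E = αΛ \ (β₁Λ ∪ ⋯ ∪ βₙΛ)` and `β₁, …, βₙ ∈ αΛ \ {α}`. -/
instance : TopologicalSpace (DirHered M) :=
  TopologicalSpace.generateFrom
    {U | ∃ (α : M) (F : Finset M), (∀ β ∈ F, β ∈ extensions α \ {α}) ∧
      U = hat (extensions α \ ⋃ β ∈ F, extensions β)}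

variable (M) in
/-- The set `Λ^{**}` of maximal directed hereditary subsets. -/
def maximalDirHered : Set (DirHered M) := {C | Maximal IsDirHered C.carrier}

variable (M) in
/-- The boundary `∂Λ`, the closure of `Λ^{**}` in `Λ^*`. -/
def boundary : Set (DirHered M) := closure (maximalDirHered M)

/-- Left multiplication `C ↦ αC` on `Λ^*`, where `αC` is the union of the sets of initial segments
of `αβ`, for `β ∈ C`. -/
def leftMul (α : M) (C : DirHered M) : DirHered M where
  carrier := {δ | ∃ β ∈ C.carrier, δ ∣ α * β}
  isDirHered := by
    obtain ⟨⟨β₀, h₀⟩, hd, -⟩ := C.isDirHered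
    refine ⟨⟨α * β₀, β₀, h₀, dvd_rfl⟩, ?_, ?_⟩
    · rintro δ₁ ⟨β₁, h₁, hδ₁⟩ δ₂ ⟨β₂, h₂, hδ₂⟩
      obtain ⟨γ, hγ, h₁γ, h₂γ⟩ := hd β₁ h₁ β₂ h₂
      exact ⟨α * γ, ⟨γ, hγ, dvd_rfl⟩, hδ₁.trans (mul_dvd_mul_left α h₁γ),
        hδ₂.trans (mul_dvd_mul_left α h₂γ)⟩
    · rintro δ ⟨β, hβ, hδ⟩ η hη
      exact ⟨β, hβ, hη.trans hδ⟩

end Monoid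

/-! ### The Baumslag-Solitar groups and their categories of paths -/

/-- The single relator `a b^c (b^{εd} a)⁻¹`; the generators `a`, `b` are the letters `0`, `1`. -/
def relators (ε : ℤˣ) (c d : ℕ) : Set (FreeGroup (Fin 2)) :=
  {FreeGroup.of 0 * FreeGroup.of 1 ^ c *
    (FreeGroup.of 1 ^ ((ε : ℤ) * (d : ℤ)) * FreeGroup.of 0)⁻¹}

/-- The group `⟨a, b ∣ a b^c = b^{εd} a⟩`, where `ε = ±1`. -/
abbrev BSGroup (ε : ℤˣ) (c d : ℕ) : Type := PresentedGroup (relators ε c d)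

variable (ε : ℤˣ) (c d : ℕ)

/-- The generator `a` of the group. -/
def genA : BSGroup ε c d := PresentedGroup.of 0

/-- The generator `b` of the group. -/
def genB : BSGroup ε c d := PresentedGroup.of 1

/-- The submonoid `Λ` generated by `a` and `b`. -/
def paths : Submonoid (BSGroup ε c d) := Submonoid.closure {genA ε c d, genB ε c d}

/-- `a` as an element of `Λ`. -/
def pathA : paths ε c d := ⟨genA ε c d, Submonoid.subset_closure (by simp)⟩

/-- `b` as an element of `Λ`. -/
def pathB : paths ε c d := ⟨genB ε c d, Submonoid.subset_closure (by simp)⟩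

variable {d}

/-- The path `α_k(i) = b^{i_0} a b^{i_1} a ⋯ b^{i_k} a`, for a sequence `i` in `[0,d)`. -/
def alpha (i : ℕ → Fin d) : ℕ → paths ε c d
  | 0 => pathB ε c d ^ (i 0 : ℕ) * pathA ε c d
  | k + 1 => alpha i k * (pathB ε c d ^ (i (k + 1) : ℕ) * pathA ε c d)

/-- The set `C_∞(i)` of all initial segments of the paths `α_k(i) b^p`, for `k, p ≥ 0`. -/
def cInf (i : ℕ → Fin d) : Set (paths ε c d) :=
  {δ | ∃ k p : ℕ, δ ∣ alpha ε c i k * pathB ε c d ^ p}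

/-- The carries `e_0 = ε`, `e_{k+1} = -ε ⌊(i_{k+1} - c e_k) / d⌋`; they are the exponents in
`b^d α_k(φ(i)) = α_k(i) b^{c e_k}`. -/
def carry (i : ℕ → Fin d) : ℕ → ℤ
  | 0 => (ε : ℤ)
  | k + 1 => -(ε : ℤ) * ((((i (k + 1) : ℕ) : ℤ) - (c : ℤ) * carry i k) / (d : ℤ))

/-- The odometer-type map `φ` of `[0,d)^ℕ`: `φ(i)_0 = i_0`, and `φ(i)_{k+1}` is the residue of
`i_{k+1} - c e_k` modulo `d` in `[0,d)`. -/
def odometer (i : ℕ → Fin d) : ℕ → Fin d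
  | 0 => i 0
  | k + 1 => ⟨((((i (k + 1) : ℕ) : ℤ) - (c : ℤ) * carry ε c i k) % (d : ℤ)).toNat, by
      have hd : (0 : ℤ) < d := by exact_mod_cast (i 0).pos
      have h1 := Int.emod_nonneg (((i (k + 1) : ℕ) : ℤ) - (c : ℤ) * carry ε c i k) hd.ne'
      have h2 := Int.emod_lt_of_pos (((i (k + 1) : ℕ) : ℤ) - (c : ℤ) * carry ε c i k) hd
      omega⟩

end BSPaths

namespace BSPaths

/-! ### Words in the group and Britton's lemma. -/

section Words

variable (ε : ℤˣ) (c d : ℕ)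

/-! Pushing multiples of `d` rightwards through `a` brings every path to the form `b^n` or `α_k(j)
b^p` with `p ∈ ℤ` (`path_normal_form`). The group is an HNN extension of `ℤ` with stable letter `a`,
and words positive in `a` are always reduced, so Britton's lemma makes the digits of `α_k(j)` unique
and preserves them under extension (`eq_of_alpha_mul_eq`).

Hence the sequences `i` with `x ∈ C_∞(i)` form the whole space or a cylinder (`setOf_mem_cInf`). A
directed hereditary set gives a directed family of nonempty compact cylinders; a common point `i`
puts it inside `C_∞(i)`. As the `C_∞(i)` are pairwise incomparable, they are exactly the maximal
sets.

The topology of `Λ^*` is that of pointwise membership, so it is Hausdorff and `i ↦ C_∞(i)` is a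
continuous injection of a compact space: its image is closed and it is a homeomorphism onto it.
Finally, `b^d` passes through `α_k(φ(i))` by division with remainder, leaving a power of `b` that
`C_∞` absorbs (`leftMul_cInf`). -/

theorem genA_mul_genB_zpow (n : ℤ) :
    genA ε c d * genB ε c d ^ ((c : ℤ) * n) = genB ε c d ^ ((ε : ℤ) * d * n) * genA ε c d := by
  have h : SemiconjBy (genA ε c d) (genB ε c d ^ (c : ℤ)) (genB ε c d ^ ((ε : ℤ) * d)) := by
    have h1 := PresentedGroup.one_of_mem (rels := relators ε c d) (Set.mem_singleton _)
    simp only [map_mul, map_inv, map_pow, map_zpow] at h1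
    rw [SemiconjBy, zpow_natCast]
    exact mul_inv_eq_one.mp (by simpa [genA, genB, PresentedGroup.of] using h1)
  simpa [SemiconjBy, zpow_mul] using (h.zpow_right n).eq

theorem genB_zpow_mul_genA (n : ℤ) :
    genB ε c d ^ ((d : ℤ) * n) * genA ε c d = genA ε c d * genB ε c d ^ ((ε : ℤ) * c * n) := by
  have h := genA_mul_genB_zpow ε c d ((ε : ℤ) * n)
  rw [show (ε : ℤ) * d * (ε * n) = (ε * ε) * (d * n) by ring, Int.units_coe_mul_self, one_mul] at h
  rw [← h]
  congr 2
  ring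

/-- The element `b^{x₁} a ⋯ b^{xₙ} a b^z` of the group, for `L = [x₁, …, xₙ]`. -/
def word (L : List ℤ) (z : ℤ) : BSGroup ε c d :=
  (L.map fun x => genB ε c d ^ x * genA ε c d).prod * genB ε c d ^ z

theorem word_cons (x : ℤ) (L : List ℤ) (z : ℤ) :
    word ε c d (x :: L) z = genB ε c d ^ x * genA ε c d * word ε c d L z := by
  simp [word, mul_assoc]

theorem word_mul_genB_zpow (L : List ℤ) (z n : ℤ) :
    word ε c d L z * genB ε c d ^ n = word ε c d L (z + n) := by
  simp [word, mul_assoc, zpow_add]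

theorem word_mul_genA (L : List ℤ) (z : ℤ) :
    word ε c d L z * genA ε c d = word ε c d (L ++ [z]) 0 := by
  simp [word, mul_assoc]

/-- Right multiplication by `b` changes only the last exponent, and by `a` only closes a syllable,
so `D` survives as a prefix. -/
theorem exists_word_mul (D : List ℤ) (p : ℤ) (w : BSGroup ε c d) (hw : w ∈ paths ε c d) :
    ∃ L z, word ε c d D p * w = word ε c d (D ++ L) z := by
  induction hw using Submonoid.closure_induction_right with
  | one => exact ⟨[], p, by simp⟩
  | mul_right x _ y hy ih =>
    obtain ⟨L, z, h⟩ := ih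
    rw [← mul_assoc, h]
    rcases hy with rfl | rfl
    · exact ⟨L ++ [z], 0, by rw [word_mul_genA, List.append_assoc]⟩
    · exact ⟨L, z + 1, by rw [← word_mul_genB_zpow, zpow_one]⟩

/-! ### Comparison with an HNN extension of `ℤ` -/

/-- The endomorphism `x ↦ n x` of `ℤ`, written multiplicatively. -/
abbrev mulHom (n : ℤ) : Multiplicative ℤ →* Multiplicative ℤ :=
  zpowersHom _ (Multiplicative.ofAdd n)

theorem mulHom_apply (n : ℤ) (x : Multiplicative ℤ) :
    mulHom n x = Multiplicative.ofAdd (x.toAdd * n) := by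
  rw [mulHom, zpowersHom_apply, ← ofAdd_zsmul, smul_eq_mul]

theorem mulHom_injective {n : ℤ} (hn : n ≠ 0) : Function.Injective (mulHom n) := by
  intro x y h
  rw [mulHom_apply, mulHom_apply] at h
  exact Multiplicative.toAdd.injective (mul_right_cancel₀ hn (Multiplicative.ofAdd.injective h))

/-- The isomorphism `mℤ ≃ nℤ` that takes `m` to `n`. -/
noncomputable def rangeEquiv {m n : ℤ} (hm : m ≠ 0) (hn : n ≠ 0) :
    (mulHom m).range ≃* (mulHom n).range :=
  (MonoidHom.ofInjective (mulHom_injective hm)).symm.trans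
    (MonoidHom.ofInjective (mulHom_injective hn))

theorem rangeEquiv_apply {m n : ℤ} (hm : m ≠ 0) (hn : n ≠ 0) (x : Multiplicative ℤ) :
    rangeEquiv hm hn ⟨mulHom m x, x, rfl⟩ = ⟨mulHom n x, x, rfl⟩ := by
  have : (⟨mulHom m x, x, rfl⟩ : (mulHom m).range) =
      MonoidHom.ofInjective (mulHom_injective hm) x := rfl
  rw [this, rangeEquiv, MulEquiv.trans_apply, MulEquiv.symm_apply_apply]
  rfl

section HNN

variable {ε c d} (hc : (c : ℤ) ≠ 0) (hd : (ε : ℤ) * d ≠ 0)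

/-- The homomorphism from the Baumslag-Solitar group to the HNN extension of `ℤ` along
`cℤ ≃ εdℤ`. -/
noncomputable def toHNN : BSGroup ε c d →* HNNExtension (Multiplicative ℤ) _ _ (rangeEquiv hc hd) :=
  PresentedGroup.toGroup
    (f := ![HNNExtension.t, HNNExtension.of (Multiplicative.ofAdd 1)]) <| by
    rintro r rfl
    have h := HNNExtension.t_mul_of (φ := rangeEquiv hc hd)
      ⟨mulHom c (Multiplicative.ofAdd 1), _, rfl⟩
    rw [rangeEquiv_apply] at h
    simp only [mulHom_apply, toAdd_ofAdd, one_mul] at h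
    simp only [map_mul, map_inv, map_pow, map_zpow, FreeGroup.lift_apply_of]
    rw [mul_inv_eq_one, Matrix.cons_val_zero, Matrix.cons_val_one, Matrix.cons_val_zero,
      ← map_pow, ← map_zpow, ← ofAdd_nsmul, ← ofAdd_zsmul]
    simpa using h

theorem toHNN_genA : toHNN hc hd (genA ε c d) = HNNExtension.t := by
  simp [toHNN, genA]

theorem toHNN_genB_zpow (x : ℤ) :
    toHNN hc hd (genB ε c d ^ x) = HNNExtension.of (Multiplicative.ofAdd x) := by
  rw [map_zpow, toHNN, genB, PresentedGroup.toGroup.of, Matrix.cons_val_one,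
    Matrix.cons_val_zero, ← map_zpow,
    ← ofAdd_zsmul]
  simp

/-- The syllables `a b^{x₂}, …, a b^{xₙ}, a b^z` of `b^{x₁} a ⋯ b^{xₙ} a b^z`. -/
def syllables : List ℤ → ℤ → List (ℤˣ × Multiplicative ℤ)
  | [], _ => []
  | _ :: L, z => (1, Multiplicative.ofAdd (L.headD z)) :: syllables L z

theorem length_syllables (L : List ℤ) (z : ℤ) : (syllables L z).length = L.length := by
  induction L with
  | nil => rfl
  | cons x L ih => simp [syllables, ih]

theorem fst_of_mem_syllables (L : List ℤ) (z : ℤ) : ∀ s ∈ syllables L z, s.1 = 1 := by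
  induction L with
  | nil => simp [syllables]
  | cons x L ih => simpa [syllables] using fun a b h => ih (a, b) h

/-- The reduced word of the HNN extension that represents `b^{x₁} a ⋯ b^{xₙ} a b^z`. -/
def reducedWord (A B : Subgroup (Multiplicative ℤ)) (L : List ℤ) (z : ℤ) :
    HNNExtension.NormalWord.ReducedWord (Multiplicative ℤ) A B where
  head := Multiplicative.ofAdd (L.headD z)
  toList := syllables L z
  -- All stable letters have exponent `+1`, so no pinch can occur, whatever the integers are.
  chain := List.Pairwise.isChain <| List.pairwise_iff_forall_sublist.mpr fun {a b} h _ => by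
    rw [fst_of_mem_syllables L z a (h.subset (by simp)),
      fst_of_mem_syllables L z b (h.subset (by simp))]

theorem toHNN_word (L : List ℤ) (z : ℤ) :
    toHNN hc hd (word ε c d L z) = (reducedWord _ _ L z).prod (rangeEquiv hc hd) := by
  induction L with
  | nil =>
    simp [word, reducedWord, syllables, HNNExtension.NormalWord.ReducedWord.prod, toHNN_genB_zpow]
  | cons x L ih =>
    rw [word_cons, map_mul, ih, map_mul, toHNN_genA, toHNN_genB_zpow]
    simp [reducedWord, syllables, HNNExtension.NormalWord.ReducedWord.prod, mul_assoc]

end HNN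

variable {ε c d}

theorem length_eq_of_word_eq (hc : 1 ≤ c) (hd : 1 ≤ d) {L L' : List ℤ} {z z' : ℤ}
    (h : word ε c d L z = word ε c d L' z') : L.length = L'.length := by
  have hc' : (c : ℤ) ≠ 0 := by positivity
  have hd' : (ε : ℤ) * d ≠ 0 := mul_ne_zero ε.ne_zero (by positivity)
  have h1 := congrArg (toHNN hc' hd') h
  rw [toHNN_word, toHNN_word] at h1
  simpa [reducedWord, length_syllables] using congrArg List.length
    (HNNExtension.ReducedWord.map_fst_eq_and_of_prod_eq _ h1).1

theorem dvd_sub_of_word_eq (hc : 1 ≤ c) (hd : 1 ≤ d) {x x' : ℤ} {L L' : List ℤ} {z z' : ℤ}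
    (h : word ε c d (x :: L) z = word ε c d (x' :: L') z') : (d : ℤ) ∣ x' - x := by
  have hc' : (c : ℤ) ≠ 0 := by positivity
  have hd' : (ε : ℤ) * d ≠ 0 := mul_ne_zero ε.ne_zero (by positivity)
  have h1 := congrArg (toHNN hc' hd') h
  rw [toHNN_word, toHNN_word] at h1
  -- Britton's lemma: the heads differ by an element of the associated subgroup `εdℤ`.
  obtain ⟨y, hy⟩ := (HNNExtension.ReducedWord.map_fst_eq_and_of_prod_eq _ h1).2 1
    (by simp [reducedWord, syllables])
  have hy' : (ε : ℤ) * d * y.toAdd = -x + x' := by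
    simpa [reducedWord, mulHom_apply, -zpowersHom_apply, ← ofAdd_neg, ← ofAdd_add] using
      congrArg Multiplicative.toAdd hy
  exact ⟨y.toAdd * ε, by linarith⟩

/-- Leading digits agree modulo `d` and lie in `[0,d)`, so they coincide; cancel the syllable and
recurse. The entries of `L` need no bounds. -/
theorem isPrefix_of_word_eq (hc : 1 ≤ c) (hd : 1 ≤ d) {D D' L : List ℤ} {z z' : ℤ}
    (hD : ∀ x ∈ D, 0 ≤ x ∧ x < d) (hD' : ∀ x ∈ D', 0 ≤ x ∧ x < d)
    (h : word ε c d (D ++ L) z = word ε c d D' z') : D <+: D' := by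
  induction D generalizing D' with
  | nil => exact List.nil_prefix
  | cons x D ih =>
    cases D' with
    | nil => simpa using length_eq_of_word_eq hc hd h
    | cons y D' =>
      obtain ⟨hx0, hxd⟩ := hD x (by simp)
      obtain ⟨hy0, hyd⟩ := hD' y (by simp)
      have hxy : x = y := by
        have := Int.eq_zero_of_abs_lt_dvd (dvd_sub_of_word_eq hc hd h) (by rw [abs_lt]; omega)
        omega
      subst hxy
      rw [List.cons_append, word_cons, word_cons] at h
      exact List.cons_prefix_cons.mpr ⟨rfl, ih (fun x hx => hD x (by simp [hx]))
        (fun x hx => hD' x (by simp [hx])) (mul_left_cancel h)⟩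

end Words

/-! ### Divisibility and normal forms of paths. -/

section Paths

variable {ε : ℤˣ} {c d : ℕ}

theorem genB_zpow_mem_paths {n : ℤ} (hn : 0 ≤ n) : genB ε c d ^ n ∈ paths ε c d := by
  lift n to ℕ using hn
  rw [zpow_natCast]
  exact pow_mem (pathB ε c d).2 n

theorem dvd_of_mul_eq {x y : paths ε c d} {w : BSGroup ε c d} (hw : w ∈ paths ε c d)
    (h : (x : BSGroup ε c d) * w = y) : x ∣ y :=
  ⟨⟨w, hw⟩, Subtype.ext h.symm⟩

theorem coe_pathB_pow (n : ℕ) :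
    ((pathB ε c d ^ n : paths ε c d) : BSGroup ε c d) = genB ε c d ^ (n : ℤ) := by
  simp [pathB]

theorem coe_pathA : (pathA ε c d : BSGroup ε c d) = genA ε c d := rfl

theorem exists_pathB_pow_dvd (hd : 1 ≤ d) (n x : ℕ) :
    ∃ p : ℕ, pathB ε c d ^ n ∣ pathB ε c d ^ x * pathA ε c d * pathB ε c d ^ p := by
  -- Since `b^{dn} a = a b^{εcn}`, the quotient by `b^n` ends in `b^{cn - εcn}`; the choice `p = cn`
  -- keeps this exponent nonnegative for both signs.
  refine ⟨c * n, dvd_of_mul_eq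
    (w := genB ε c d ^ ((d : ℤ) * n + x - n) * genA ε c d *
      genB ε c d ^ ((c : ℤ) * n - ε * c * n)) ?_ ?_⟩
  · refine mul_mem (mul_mem (genB_zpow_mem_paths ?_) (pathA ε c d).2) (genB_zpow_mem_paths ?_)
    · have : (n : ℤ) ≤ d * n := le_mul_of_one_le_left (by positivity) (by exact_mod_cast hd)
      linarith [Int.natCast_nonneg x]
    · have : (0 : ℤ) ≤ c * n := by positivity
      rcases Int.units_eq_one_or ε with rfl | rfl <;> push_cast <;> linarith
  · have h := genB_zpow_mul_genA ε c d n
    simp only [Submonoid.coe_mul, coe_pathB_pow, coe_pathA]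
    rw [← mul_assoc, ← mul_assoc, ← zpow_add,
      show (n : ℤ) + (d * n + x - n) = x + d * n by ring, zpow_add, mul_assoc (genB ε c d ^ (x : ℤ)),
      h, mul_assoc, mul_assoc, ← zpow_add, ← mul_assoc]
    congr 2
    push_cast
    ring

theorem genB_zpow_mul_genA_eq (z : ℤ) :
    genB ε c d ^ z * genA ε c d =
      genB ε c d ^ (z % d) * genA ε c d * genB ε c d ^ ((ε : ℤ) * c * (z / d)) := by
  rw [mul_assoc, ← genB_zpow_mul_genA, ← mul_assoc, ← zpow_add, Int.emod_add_mul_ediv]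

/-- The first `k + 1` digits of a sequence. -/
def digits (i : ℕ → Fin d) (k : ℕ) : List ℤ := (List.range (k + 1)).map fun n => ((i n : ℕ) : ℤ)

theorem coe_alpha_mul (i : ℕ → Fin d) (k : ℕ) (z : ℤ) :
    (alpha ε c i k : BSGroup ε c d) * genB ε c d ^ z = word ε c d (digits i k) z := by
  induction k generalizing z with
  | zero => simp [alpha, word, digits, pathA, pathB]
  | succ k ih =>
    have h : digits i (k + 1) = digits i k ++ [((i (k + 1) : ℕ) : ℤ)] := by
      rw [digits, List.range_succ, List.map_append, digits, List.map_singleton]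
    rw [h, alpha, Submonoid.coe_mul, Submonoid.coe_mul, coe_pathB_pow, coe_pathA, ← mul_assoc, ih,
      word_mul_genA, word_mul_genB_zpow, zero_add]

theorem alpha_congr {i j : ℕ → Fin d} {k : ℕ} (h : ∀ n ≤ k, i n = j n) :
    alpha ε c i k = alpha ε c j k := by
  induction k with
  | zero => rw [alpha, alpha, h 0 le_rfl]
  | succ k ih => rw [alpha, alpha, h _ le_rfl, ih fun n hn => h n (by omega)]

theorem eq_of_alpha_mul_eq (hc : 1 ≤ c) (hd : 1 ≤ d) {i j : ℕ → Fin d} {k m : ℕ} {p q : ℤ}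
    {w : BSGroup ε c d} (hw : w ∈ paths ε c d)
    (h : (alpha ε c i k : BSGroup ε c d) * genB ε c d ^ p * w =
      (alpha ε c j m : BSGroup ε c d) * genB ε c d ^ q) : ∀ n ≤ k, i n = j n := by
  have hdig (i : ℕ → Fin d) (k : ℕ) : ∀ x ∈ digits i k, 0 ≤ x ∧ x < d := by
    simp [digits]
  rw [coe_alpha_mul, coe_alpha_mul] at h
  obtain ⟨L, z, hL⟩ := exists_word_mul ε c d (digits i k) p w hw
  rw [hL] at h
  have hpre := isPrefix_of_word_eq hc hd (hdig i k) (hdig j m) h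
  intro n hn
  have := hpre.getElem (i := n) (by simp [digits]; omega)
  simpa [digits, Fin.ext_iff] using this

/-- The final exponent must range over `ℤ`: for `ε = -1`, moving `b^d` past `a` makes it negative.
-/
theorem path_normal_form (hd : 1 ≤ d) (x : paths ε c d) :
    (∃ n : ℕ, x = pathB ε c d ^ n) ∨ ∃ (j : ℕ → Fin d) (k : ℕ) (p : ℤ),
      (x : BSGroup ε c d) = alpha ε c j k * genB ε c d ^ p := by
  have hd0 : (0 : ℤ) < d := by exact_mod_cast hd
  have hdigit (z : ℤ) : ∃ r : Fin d, ((r : ℕ) : ℤ) = z % d := by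
    have h1 := Int.emod_nonneg z hd0.ne'
    have h2 := Int.emod_lt_of_pos z hd0
    exact ⟨⟨(z % d).toNat, by omega⟩, Int.toNat_of_nonneg h1⟩
  obtain ⟨x, hx⟩ := x
  induction hx using Submonoid.closure_induction_right with
  | one => exact .inl ⟨0, rfl⟩
  | mul_right x hx y hy ih =>
    have hyB : y = genB ε c d ∨ y = genA ε c d := Or.symm hy
    rcases ih with ⟨n, hn⟩ | ⟨j, k, p, hp⟩
    · have hn' : x = genB ε c d ^ (n : ℤ) := by rw [← coe_pathB_pow, ← hn]
      rcases hyB with rfl | rfl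
      · refine .inl ⟨n + 1, Subtype.ext ?_⟩
        rw [coe_pathB_pow, Nat.cast_add_one, zpow_add_one, ← hn']
      · obtain ⟨r, hr⟩ := hdigit n
        refine .inr ⟨fun _ => r, 0, (ε : ℤ) * c * (n / d), ?_⟩
        simp only [hn', alpha, Submonoid.coe_mul, coe_pathB_pow, coe_pathA, hr]
        exact genB_zpow_mul_genA_eq _
    · change x = _ at hp
      rcases hyB with rfl | rfl
      · exact .inr ⟨j, k, p + 1, by simp only [hp]; rw [mul_assoc, zpow_add_one]⟩
      · obtain ⟨r, hr⟩ := hdigit p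
        refine .inr ⟨Function.update j (k + 1) r, k + 1, (ε : ℤ) * c * (p / d), ?_⟩
        have h : alpha ε c (Function.update j (k + 1) r) k = alpha ε c j k :=
          alpha_congr fun n hn => Function.update_of_ne (by omega) _ _
        simp only [hp, alpha, h, Function.update_self, Submonoid.coe_mul, coe_pathB_pow,
          coe_pathA, hr]
        rw [mul_assoc, genB_zpow_mul_genA_eq, mul_assoc (alpha ε c j k : BSGroup ε c d)]

/-! ### The sets `C_∞(i)` -/

/-- A negative `p` is harmless: right multiplication by a power of `b` raises it to `0`. -/
theorem mem_cInf_of_eq {i : ℕ → Fin d} {x : paths ε c d} {k : ℕ} {p : ℤ}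
    (h : (x : BSGroup ε c d) = alpha ε c i k * genB ε c d ^ p) : x ∈ cInf ε c i :=
  ⟨k, p.toNat, dvd_of_mul_eq (w := genB ε c d ^ ((p.toNat : ℤ) - p))
    (genB_zpow_mem_paths (by have := Int.self_le_toNat p; omega)) <| by
    rw [h, Submonoid.coe_mul, coe_pathB_pow, mul_assoc, ← zpow_add, add_sub_cancel]⟩

theorem pathB_pow_mem_cInf (hd : 1 ≤ d) (i : ℕ → Fin d) (n : ℕ) : pathB ε c d ^ n ∈ cInf ε c i :=
  let ⟨p, hp⟩ := exists_pathB_pow_dvd hd n (i 0 : ℕ)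
  ⟨0, p, hp⟩

/-- Each further syllable absorbs the trailing power of `b`; this is what makes `C_∞(i)` directed.
-/
theorem exists_alpha_mul_dvd (hd : 1 ≤ d) (i : ℕ → Fin d) {k m : ℕ} (hkm : k ≤ m) (p : ℕ) :
    ∃ q : ℕ, alpha ε c i k * pathB ε c d ^ p ∣ alpha ε c i m * pathB ε c d ^ q := by
  induction m, hkm using Nat.le_induction with
  | base => exact ⟨p, dvd_rfl⟩
  | succ m _ ih =>
    obtain ⟨q, hq⟩ := ih
    obtain ⟨r, hr⟩ := exists_pathB_pow_dvd (ε := ε) (c := c) hd q (i (m + 1) : ℕ)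
    refine ⟨r, hq.trans ?_⟩
    rw [alpha, mul_assoc (alpha ε c i m)]
    exact mul_dvd_mul_left _ hr

theorem isDirHered_cInf (hd : 1 ≤ d) (i : ℕ → Fin d) : IsDirHered (cInf ε c i) := by
  refine ⟨⟨_, pathB_pow_mem_cInf hd i 0⟩, ?_, fun x ⟨k, p, h⟩ y hy => ⟨k, p, hy.trans h⟩⟩
  rintro x ⟨k, p, hx⟩ y ⟨m, q, hy⟩
  obtain ⟨p', hp⟩ := exists_alpha_mul_dvd (ε := ε) (c := c) hd i (le_max_left k m) p
  obtain ⟨q', hq⟩ := exists_alpha_mul_dvd (ε := ε) (c := c) hd i (le_max_right k m) q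
  refine ⟨_, ⟨max k m, max p' q', dvd_rfl⟩, (hx.trans hp).trans ?_, (hy.trans hq).trans ?_⟩
  · exact mul_dvd_mul_left _ (pow_dvd_pow _ (le_max_left _ _))
  · exact mul_dvd_mul_left _ (pow_dvd_pow _ (le_max_right _ _))

theorem eq_of_cInf_subset (hc : 1 ≤ c) (hd : 1 ≤ d) {i j : ℕ → Fin d}
    (h : cInf ε c i ⊆ cInf ε c j) : i = j := by
  funext n
  obtain ⟨m, q, w, hw⟩ := h ⟨n, 0, dvd_rfl⟩
  refine eq_of_alpha_mul_eq hc hd (p := 0) (q := q) (m := m) w.2 ?_ n le_rfl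
  rw [← coe_pathB_pow, ← Submonoid.coe_mul, hw]
  simp

theorem setOf_mem_cInf (hc : 1 ≤ c) (hd : 1 ≤ d) (x : paths ε c d) :
    {i | x ∈ cInf ε c i} = Set.univ ∨
      ∃ (j : ℕ → Fin d) (k : ℕ), {i | x ∈ cInf ε c i} = {i | ∀ n ≤ k, j n = i n} := by
  rcases path_normal_form hd x with ⟨n, rfl⟩ | ⟨j, k, p, hx⟩
  · exact .inl (Set.eq_univ_of_forall fun i => pathB_pow_mem_cInf hd i n)
  · refine .inr ⟨j, k, Set.ext fun i => ⟨?_, fun h => ?_⟩⟩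
    · rintro ⟨m, q, w, hw⟩
      refine eq_of_alpha_mul_eq hc hd (p := p) (q := q) (m := m) w.2 ?_
      rw [← coe_pathB_pow, ← Submonoid.coe_mul, hw, Submonoid.coe_mul, hx]
    · exact mem_cInf_of_eq (hx.trans (by rw [alpha_congr h]))

theorem nonempty_setOf_mem_cInf (hc : 1 ≤ c) (hd : 1 ≤ d) (x : paths ε c d) :
    {i | x ∈ cInf ε c i}.Nonempty := by
  rcases setOf_mem_cInf hc hd x with h | ⟨j, k, h⟩
  · rw [h]
    exact ⟨fun _ => ⟨0, hd⟩, trivial⟩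
  · rw [h]
    exact ⟨j, fun _ _ => rfl⟩

theorem isClopen_setOf_mem_cInf (hc : 1 ≤ c) (hd : 1 ≤ d) (x : paths ε c d) :
    IsClopen {i | x ∈ cInf ε c i} := by
  rcases setOf_mem_cInf hc hd x with h | ⟨j, k, h⟩
  · rw [h]
    exact isClopen_univ
  · rw [h]
    simp only [Set.ofPred_forall]
    exact (Set.finite_Iic k).isClopen_biInter fun n _ =>
      (isClopen_discrete {j n}).preimage (continuous_apply n) |> fun h => by
        simpa [Set.preimage, eq_comm] using h

theorem exists_subset_cInf (hc : 1 ≤ c) (hd : 1 ≤ d) {C : Set (paths ε c d)} (hC : IsDirHered C) :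
    ∃ i : ℕ → Fin d, C ⊆ cInf ε c i := by
  obtain ⟨hne, hdir, -⟩ := hC
  have := hne.to_subtype
  -- A common extension lies in fewer `C_∞(i)`, by heredity.
  have hS : Directed (· ⊇ ·) fun x : C => {i | x.1 ∈ cInf ε c i} := fun x y =>
    let ⟨z, hz, hxz, hyz⟩ := hdir x x.2 y y.2
    ⟨⟨z, hz⟩, fun i h => (isDirHered_cInf hd i).2.2 _ h _ hxz,
      fun i h => (isDirHered_cInf hd i).2.2 _ h _ hyz⟩
  obtain ⟨i, hi⟩ := IsCompact.nonempty_iInter_of_directed_nonempty_isCompact_isClosed _ hS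
    (fun x => nonempty_setOf_mem_cInf hc hd x.1)
    (fun x => (isClopen_setOf_mem_cInf hc hd x.1).isClosed.isCompact)
    (fun x => (isClopen_setOf_mem_cInf hc hd x.1).isClosed)
  exact ⟨i, fun x hx => Set.mem_iInter.mp hi ⟨x, hx⟩⟩

theorem maximal_isDirHered_iff (hc : 1 ≤ c) (hd : 1 ≤ d) {C : Set (paths ε c d)} :
    Maximal IsDirHered C ↔ ∃ i : ℕ → Fin d, cInf ε c i = C := by
  constructor
  · intro h
    obtain ⟨i, hi⟩ := exists_subset_cInf hc hd h.prop
    exact ⟨i, (h.eq_of_subset (isDirHered_cInf hd i) hi).symm⟩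
  · rintro ⟨i, rfl⟩
    refine ⟨isDirHered_cInf hd i, fun D hD hle => ?_⟩
    obtain ⟨j, hj⟩ := exists_subset_cInf hc hd hD
    rwa [eq_of_cInf_subset hc hd (hle.trans hj)]

end Paths

/-! ### The topology of `Λ^*` -/

section Topology

variable {M : Type*} [Monoid M]

/-- A `β ∈ F` in `C` would have a common extension with `γ` in `C`; conversely `γ = α` works. -/
theorem mem_hat_iff {α : M} {F : Finset M} {C : DirHered M} :
    C ∈ hat (extensions α \ ⋃ β ∈ F, extensions β) ↔
      α ∈ C.carrier ∧ ∀ β ∈ F, β ∉ C.carrier := by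
  obtain ⟨-, hdir, hher⟩ := C.isDirHered
  constructor
  · rintro ⟨γ, hγ, h⟩
    refine ⟨hher γ hγ α (h ⟨hγ, dvd_rfl⟩).1, fun β hβ hβC => ?_⟩
    obtain ⟨δ, hδ, hγδ, hβδ⟩ := hdir γ hγ β hβC
    exact (h ⟨hδ, hγδ⟩).2 (Set.mem_biUnion hβ hβδ)
  · rintro ⟨hα, h⟩
    refine ⟨α, hα, fun δ hδ => ⟨hδ.2, fun hmem => ?_⟩⟩
    obtain ⟨β, hβ, hβδ⟩ := Set.mem_iUnion₂.mp hmem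
    exact h β hβ (hher δ hδ.1 β hβδ)

theorem one_mem_carrier (C : DirHered M) : (1 : M) ∈ C.carrier :=
  let ⟨x, hx⟩ := C.isDirHered.1
  C.isDirHered.2.2 x hx 1 (one_dvd x)

theorem isClopen_setOf_mem_carrier (α : M) : IsClopen {C : DirHered M | α ∈ C.carrier} := by
  refine ⟨⟨?_⟩, TopologicalSpace.isOpen_generateFrom_of_mem
    ⟨α, ∅, by simp, Set.ext fun C => by rw [mem_hat_iff]; simp⟩⟩
  -- The complement is the basic set for `1Λ \ αΛ`, which is admissible only if `α ≠ 1`.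
  by_cases hα : α = 1
  · subst hα
    simp [one_mem_carrier]
  · exact TopologicalSpace.isOpen_generateFrom_of_mem
      ⟨1, {α}, by simpa [extensions] using hα, Set.ext fun C => by
        rw [mem_hat_iff]; simp [one_mem_carrier]⟩

theorem continuous_dirHered_iff {X : Type*} [TopologicalSpace X] {f : X → DirHered M} :
    Continuous f ↔ ∀ α, IsClopen {x | α ∈ (f x).carrier} := by
  refine ⟨fun h α => (isClopen_setOf_mem_carrier α).preimage h, fun h => ?_⟩
  refine continuous_generateFrom_iff.mpr ?_
  rintro _ ⟨α, F, -, rfl⟩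
  have : f ⁻¹' hat (extensions α \ ⋃ β ∈ F, extensions β) =
      {x | α ∈ (f x).carrier} ∩ ⋂ β ∈ F, {x | β ∈ (f x).carrier}ᶜ := by
    ext x
    rw [Set.mem_preimage, mem_hat_iff]
    simp
  rw [this]
  exact (h α).isOpen.inter (isOpen_biInter_finset fun β _ => (h β).compl.isOpen)

theorem DirHered.carrier_injective : Function.Injective (DirHered.carrier (M := M)) := by
  rintro ⟨C, _⟩ ⟨D, _⟩ rfl
  rfl

instance : T2Space (DirHered M) where
  t2 C D hne := by
    have h : ∃ α, ¬(α ∈ C.carrier ↔ α ∈ D.carrier) := by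
      by_contra! h
      exact hne (DirHered.carrier_injective (Set.ext h))
    obtain ⟨α, h⟩ := h
    have hα := isClopen_setOf_mem_carrier α
    by_cases hC : α ∈ C.carrier
    · exact ⟨_, _, hα.isOpen, hα.compl.isOpen, hC, fun hD => h (by tauto), disjoint_compl_right⟩
    · exact ⟨_, _, hα.compl.isOpen, hα.isOpen, hC, by simp only [Set.mem_ofPred_eq]; tauto,
        disjoint_compl_left⟩

end Topology

/-! ### The boundary as a compact image. -/

section Boundary

variable (ε : ℤˣ) {c d : ℕ}

/-- The map `i ↦ C_∞(i)` into `Λ^*`. -/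
def cInfDirHered (hd : 1 ≤ d) (i : ℕ → Fin d) : DirHered (paths ε c d) :=
  ⟨cInf ε c i, isDirHered_cInf hd i⟩

theorem continuous_cInfDirHered (hc : 1 ≤ c) (hd : 1 ≤ d) :
    Continuous (cInfDirHered ε (c := c) hd) :=
  continuous_dirHered_iff.mpr (isClopen_setOf_mem_cInf hc hd)

theorem cInfDirHered_injective (hc : 1 ≤ c) (hd : 1 ≤ d) :
    Function.Injective (cInfDirHered ε (c := c) hd) := fun _ _ h =>
  eq_of_cInf_subset hc hd (congrArg DirHered.carrier h).subset

theorem range_cInfDirHered (hc : 1 ≤ c) (hd : 1 ≤ d) :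
    Set.range (cInfDirHered ε (c := c) hd) = maximalDirHered (paths ε c d) := by
  ext C
  exact (exists_congr fun i => DirHered.carrier_injective.eq_iff.symm).trans
    (maximal_isDirHered_iff hc hd).symm

theorem isClosed_maximalDirHered (hc : 1 ≤ c) (hd : 1 ≤ d) :
    IsClosed (maximalDirHered (paths ε c d)) := by
  rw [← range_cInfDirHered ε hc hd]
  exact (isCompact_range (continuous_cInfDirHered ε hc hd)).isClosed

theorem boundary_eq_maximalDirHered (hc : 1 ≤ c) (hd : 1 ≤ d) :
    boundary (paths ε c d) = maximalDirHered (paths ε c d) :=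
  (isClosed_maximalDirHered ε hc hd).closure_eq

theorem range_cInfDirHered_eq_boundary (hc : 1 ≤ c) (hd : 1 ≤ d) :
    Set.range (cInfDirHered ε (c := c) hd) = boundary (paths ε c d) :=
  (range_cInfDirHered ε hc hd).trans (boundary_eq_maximalDirHered ε hc hd).symm

/-- The homeomorphism `i ↦ C_∞(i)` onto the boundary. -/
noncomputable def cInfHomeomorph (hc : 1 ≤ c) (hd : 1 ≤ d) :
    (ℕ → Fin d) ≃ₜ boundary (paths ε c d) :=
  Continuous.homeoOfEquivCompactToT2
    (f := (Equiv.ofInjective _ (cInfDirHered_injective ε hc hd)).trans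
      (Equiv.setCongr (range_cInfDirHered_eq_boundary ε hc hd)))
    ((continuous_cInfDirHered ε hc hd).subtype_mk _)

end Boundary

/-! ### The odometer and multiplication by `b^d`. -/

section Odometer

variable (ε : ℤˣ) (c : ℕ) {d : ℕ}

theorem coe_odometer_succ (i : ℕ → Fin d) (k : ℕ) :
    ((odometer ε c i (k + 1) : ℕ) : ℤ) = (((i (k + 1) : ℕ) : ℤ) - c * carry ε c i k) % d :=
  Int.toNat_of_nonneg (Int.emod_nonneg _ (by have := (i 0).pos; omega))

theorem carry_congr {i j : ℕ → Fin d} {k : ℕ} (h : ∀ n ≤ k, i n = j n) :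
    carry ε c i k = carry ε c j k := by
  induction k with
  | zero => rfl
  | succ k ih => rw [carry, carry, h _ le_rfl, ih fun n hn => h n (by omega)]

theorem isLocallyConstant_carry (k : ℕ) :
    IsLocallyConstant fun i : ℕ → Fin d => carry ε c i k := by
  induction k with
  | zero => exact IsLocallyConstant.const _
  | succ k ih =>
    have h : IsLocallyConstant fun i : ℕ → Fin d => i (k + 1) :=
      (IsLocallyConstant.iff_continuous _).mpr (continuous_apply _)
    exact h.comp₂ ih fun x e => -(ε : ℤ) * ((((x : ℕ) : ℤ) - c * e) / d)

theorem continuous_odometer : Continuous (odometer ε c (d := d)) := by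
  refine continuous_pi fun k => ?_
  cases k with
  | zero => exact continuous_apply 0
  | succ k =>
    have h : IsLocallyConstant fun i : ℕ → Fin d => i (k + 1) :=
      (IsLocallyConstant.iff_continuous _).mpr (continuous_apply _)
    have h2 := h.comp₂ (isLocallyConstant_carry ε c k)
      fun x e => (((x : ℕ) : ℤ) - c * e) % d
    have h3 : IsLocallyConstant fun i : ℕ → Fin d => odometer ε c i (k + 1) := by
      refine IsLocallyConstant.desc (fun i : ℕ → Fin d => odometer ε c i (k + 1))
        (fun x : Fin d => ((x : ℕ) : ℤ)) ?_ fun x y hxy => Fin.ext (Int.ofNat.inj hxy)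
      simpa only [Function.comp_def, coe_odometer_succ] using h2
    exact h3.continuous

theorem odometer_injective : Function.Injective (odometer ε c (d := d)) := by
  intro i j h
  funext k
  induction k using Nat.strong_induction_on with
  | _ k ih =>
    cases k with
    | zero => exact congrFun h 0
    | succ k =>
      have h1 := congrArg (fun x : Fin d => ((x : ℕ) : ℤ)) (congrFun h (k + 1))
      simp only [coe_odometer_succ] at h1
      rw [carry_congr ε c fun n hn => ih n (by omega)] at h1
      have h2 : ((i (k + 1) : ℕ) : ℤ) ≡ (j (k + 1) : ℕ) [ZMOD d] :=
        by
        simpa only [sub_add_cancel] using Int.ModEq.add_right (c * carry ε c j k) h1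
      exact Fin.ext ((Int.natCast_modEq_iff.mp h2).eq_of_lt_of_lt (i _).2 (j _).2)

theorem odometer_surjective : Function.Surjective (odometer ε c (d := d)) := by
  intro y
  have hd : (0 : ℤ) < d := by exact_mod_cast (y 0).pos
  let digit (z : ℤ) : Fin d := ⟨(z % d).toNat, by
    have h1 := Int.emod_nonneg z hd.ne'
    have h2 := Int.emod_lt_of_pos z hd
    omega⟩
  have hdigit (z : ℤ) : ((digit z : ℕ) : ℤ) = z % d :=
    Int.toNat_of_nonneg (Int.emod_nonneg z hd.ne')
  -- Solves for the preimage digit by digit, with its carry: `i_{k+1}` is the residue of `y_{k+1} +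
  -- c e_k`.
  let s : ℕ → Fin d × ℤ := Nat.rec (y 0, (ε : ℤ)) fun k p =>
    (digit ((y (k + 1) : ℕ) + c * p.2),
      -(ε : ℤ) * ((((digit ((y (k + 1) : ℕ) + c * p.2) : ℕ) : ℤ) - c * p.2) / d))
  have hs (k : ℕ) : carry ε c (fun n => (s n).1) k = (s k).2 := by
    induction k with
    | zero => rfl
    | succ k ih => rw [carry, ih]
  refine ⟨fun n => (s n).1, funext fun k => ?_⟩
  cases k with
  | zero => rfl
  | succ k =>
    refine Fin.ext (Nat.cast_injective (R := ℤ) ?_)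
    rw [coe_odometer_succ, hs]
    change (((digit ((y (k + 1) : ℕ) + c * (s k).2) : ℕ) : ℤ) - c * (s k).2) % d = _
    rw [hdigit, Int.emod_sub_emod, add_sub_cancel_right,
      Int.emod_eq_of_lt (by positivity) (by exact_mod_cast (y (k + 1)).2)]

/-- The odometer as a homeomorphism. -/
noncomputable def odometerHomeomorph : (ℕ → Fin d) ≃ₜ (ℕ → Fin d) :=
  Continuous.homeoOfEquivCompactToT2
    (f := Equiv.ofBijective _ ⟨odometer_injective ε c, odometer_surjective ε c⟩)
    (continuous_odometer ε c)

theorem genB_pow_mul_alpha_odometer (i : ℕ → Fin d) (k : ℕ) :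
    genB ε c d ^ d * (alpha ε c (odometer ε c i) k : BSGroup ε c d) =
      (alpha ε c i k : BSGroup ε c d) * genB ε c d ^ ((c : ℤ) * carry ε c i k) := by
  induction k with
  | zero =>
    have h := genB_zpow_mul_genA ε c d 1
    simp only [alpha, carry, odometer, Submonoid.coe_mul, coe_pathB_pow, coe_pathA]
    rw [mul_one, mul_one, mul_comm (ε : ℤ)] at h
    rw [← zpow_natCast _ d, ← mul_assoc, ← zpow_add, add_comm, zpow_add, mul_assoc, h, ← mul_assoc]
  | succ k ih =>
    simp only [alpha, Submonoid.coe_mul, coe_pathB_pow, coe_pathA]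
    rw [← mul_assoc, ih, carry, coe_odometer_succ]
    set e := carry ε c i k
    set x := ((i (k + 1) : ℕ) : ℤ)
    have h := genB_zpow_mul_genA ε c d (-((x - c * e) / d))
    have h1 : (c : ℤ) * e + (x - c * e) % d = x + d * -((x - c * e) / d) := by
      have := Int.emod_add_mul_ediv (x - c * e) d
      linarith
    rw [mul_assoc, ← mul_assoc (genB ε c d ^ ((c : ℤ) * e)), ← zpow_add, h1, zpow_add, mul_assoc,
      h, show (c : ℤ) * (-ε * ((x - c * e) / d)) = ε * c * -((x - c * e) / d) by ring]
    simp only [mul_assoc]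

theorem leftMul_cInf (hd : 1 ≤ d) (i : ℕ → Fin d) :
    leftMul (pathB ε c d ^ d) (cInfDirHered ε hd (odometer ε c i)) = cInfDirHered ε hd i := by
  have key (k p : ℕ) : ((pathB ε c d ^ d * (alpha ε c (odometer ε c i) k * pathB ε c d ^ p) :
      paths ε c d) : BSGroup ε c d) =
      alpha ε c i k * genB ε c d ^ ((c : ℤ) * carry ε c i k + p) := by
    rw [Submonoid.coe_mul, Submonoid.coe_mul, coe_pathB_pow, coe_pathB_pow, zpow_natCast _ d,
      ← mul_assoc, genB_pow_mul_alpha_odometer, mul_assoc, ← zpow_add]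
  refine DirHered.carrier_injective (Set.ext fun x => ⟨?_, ?_⟩)
  · rintro ⟨y, ⟨k, p, hy⟩, hx⟩
    exact (isDirHered_cInf hd i).2.2 _ (mem_cInf_of_eq (key k p)) x
      (hx.trans (mul_dvd_mul_left _ hy))
  · rintro ⟨k, p, hx⟩
    -- Chosen so that, after adding `c e_k`, the exponent is at least `p`.
    refine ⟨_, ⟨k, (p - (c : ℤ) * carry ε c i k).toNat, dvd_rfl⟩, hx.trans ?_⟩
    have hle := Int.self_le_toNat (p - (c : ℤ) * carry ε c i k)
    refine dvd_of_mul_eq (genB_zpow_mem_paths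
      (n := (c : ℤ) * carry ε c i k + (p - (c : ℤ) * carry ε c i k).toNat - p) (by linarith)) ?_
    rw [key, Submonoid.coe_mul, coe_pathB_pow, mul_assoc, ← zpow_add, add_sub_cancel]

end Odometer

end BSPaths

theorem corollaryc (ε : ℤˣ) (c d : ℕ) (hc : 1 ≤ c) (hd : 1 ≤ d) :
    IsClosed (BSPaths.maximalDirHered (BSPaths.paths ε c d)) ∧
    BSPaths.boundary (BSPaths.paths ε c d) = BSPaths.maximalDirHered (BSPaths.paths ε c d) ∧
    ∃ (h : BSPaths.boundary (BSPaths.paths ε c d) ≃ₜ (ℕ → Fin d))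
      (φ : (ℕ → Fin d) ≃ₜ (ℕ → Fin d)),
      (∀ i : ℕ → Fin d, (h.symm i).1.carrier = BSPaths.cInf ε c i) ∧
      (∀ i : ℕ → Fin d, φ i = BSPaths.odometer ε c i) ∧
      (∀ (i : ℕ → Fin d) (k : ℕ),
        BSPaths.genB ε c d ^ d * (BSPaths.alpha ε c (φ i) k : BSPaths.BSGroup ε c d) =
          (BSPaths.alpha ε c i k : BSPaths.BSGroup ε c d) *
            BSPaths.genB ε c d ^ ((c : ℤ) * BSPaths.carry ε c i k)) ∧
      ∀ x : BSPaths.boundary (BSPaths.paths ε c d),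
        ∃ hx : BSPaths.leftMul (BSPaths.pathB ε c d ^ d) x.1 ∈
            BSPaths.boundary (BSPaths.paths ε c d),
          h ⟨BSPaths.leftMul (BSPaths.pathB ε c d ^ d) x.1, hx⟩ = φ.symm (h x) := by
  refine ⟨BSPaths.isClosed_maximalDirHered ε hc hd, BSPaths.boundary_eq_maximalDirHered ε hc hd,
    (BSPaths.cInfHomeomorph ε hc hd).symm, BSPaths.odometerHomeomorph ε c, fun i => rfl,
    fun i => rfl, BSPaths.genB_pow_mul_alpha_odometer ε c, fun x => ?_⟩
  obtain ⟨j, rfl⟩ := (BSPaths.cInfHomeomorph ε hc hd).surjective x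
  -- Writing the point as `C_∞(φ(i))` avoids computing `φ⁻¹`.
  obtain ⟨i, rfl⟩ := (BSPaths.odometerHomeomorph ε c).surjective j
  have h : BSPaths.leftMul (BSPaths.pathB ε c d ^ d)
      (BSPaths.cInfHomeomorph ε hc hd (BSPaths.odometerHomeomorph ε c i)).1 =
      (BSPaths.cInfHomeomorph ε hc hd i).1 := BSPaths.leftMul_cInf ε c hd i
  refine ⟨h ▸ (BSPaths.cInfHomeomorph ε hc hd i).2, ?_⟩
  rw [Homeomorph.symm_apply_apply, Homeomorph.symm_apply_apply, Homeomorph.symm_apply_eq]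
  exact Subtype.ext h
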